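/- Let $\mathbb N_\infty=\{1,2,3,\dots\}\cup\{\infty\}$ be the semigroup under addition with $n+\infty=\infty+n=\infty+\infty=\infty$. Let $\ell^1(\mathbb N_\infty)$ be the complex convolution algebra, $\delta_s*\delta_t=\delta_{s+t}$, whose dual space is $\ell^\infty(\mathbb N_\infty)$ via $\langle f,a\rangle=\sum_s a_s f(s)$. A \emph{predual} of $\ell^1(\mathbb N_\infty)$ is a norm-closed linear subspace $E\subseteq\ell^\infty(\mathbb N_\infty)$ such that (i) $E$ is a submodule for the actions $\langle a\cdot f,b\rangle=\langle f,b*a\rangle$ and $\langle f\cdot a,b\rangle=\langle f,a*b\rangle$ of $\ell^1(\mathbb N_\infty)$ on its dual space, and (ii) the canonical map $\ell^1(\mathbb N_\infty)\to E^*$, $a\mapsto(f\mapsto\langle f,a\rangle)$, is an isomorphism of Banach spaces (not necessarily isometric). A predual $E$ is a \emph{Hopf algebra predual} if moreover the coproduct $\Gamma:\ell^1(\mathbb N_\infty)\to\ell^1(\mathbb N_\infty\times\mathbb N_\infty)$, the bounded linear map with $\Gamma(\delta_s)=\delta_{(s,s)}$, is weak$^*$-continuous, that is, continuous from the topology $\sigma(\ell^1(\mathbb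 N_\infty),E)$ to the topology $\sigma(\ell^1(\mathbb N_\infty\times\mathbb N_\infty),E\check\otimes E)$, where $E\check\otimes E$ is the norm closure in $\ell^\infty(\mathbb N_\infty\times\mathbb N_\infty)$ of the linear span of the functions $(s,t)\mapsto f(s)g(t)$, $f,g\in E$. Let $$c=\Big\{f\in\ell^\infty(\mathbb N_\infty):\lim_{n\to\infty}f(n)=f(\infty)\Big\}$$ be the space of convergent sequences. Then $c$ is the only Hopf algebra predual of $\ell^1(\mathbb N_\infty)$: a linear subspace $E\subseteq\ell^\infty(\mathbb N_\infty)$ is a Hopf algebra predual of $\ell^1(\mathbb N_\infty)$ if and only if $E=c$. -/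

import Mathlib

open Filter Topology
open scoped ENNReal

noncomputable section

namespace SemigroupPredual

/-- The Banach space `ℓ¹(S)` of absolutely summable complex families. -/
abbrev L1 (S : Type*) : Type _ := lp (fun _ : S => ℂ) 1

/-- The Banach space `ℓ^∞(S)` of bounded complex families, with the supremum norm. -/
abbrev LInf (S : Type*) : Type _ := lp (fun _ : S => ℂ) ∞

section Pairing

variable {S : Type*}

open Classical in
/-- The standard unit vector `δ_s` of `ℓ¹(S)`. -/
def delta (s : S) : L1 S := lp.single 1 s (1 : ℂ)

theorem summable_norm (a : L1 S) : Summable fun s => ‖a s‖ := by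
  simpa using (lp.memℓp a).summable (by simp)

theorem norm_eq_tsum (a : L1 S) : ‖a‖ = ∑' s, ‖a s‖ := by
  simpa using lp.norm_eq_tsum_rpow (p := 1) (by simp) a

theorem norm_apply_le (f : LInf S) (s : S) : ‖f s‖ ≤ ‖f‖ :=
  lp.norm_apply_le_norm ENNReal.top_ne_zero f s

theorem norm_mul_le (f : LInf S) (a : L1 S) (s : S) : ‖a s * f s‖ ≤ ‖a s‖ * ‖f‖ := by
  rw [norm_mul]
  exact mul_le_mul_of_nonneg_left (norm_apply_le f s) (norm_nonneg _)

theorem summable_pairing (f : LInf S) (a : L1 S) : Summable fun s => a s * f s :=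
  Summable.of_norm_bounded ((summable_norm a).mul_right ‖f‖) (norm_mul_le f a)

/-- The duality `⟨f, a⟩ = ∑ₛ aₛ f(s)` between `ℓ^∞(S)` and `ℓ¹(S)`, through which
`ℓ^∞(S)` is the dual space of `ℓ¹(S)`. -/
def pairing : LInf S →L[ℂ] L1 S →L[ℂ] ℂ :=
  LinearMap.mkContinuous₂
    (LinearMap.mk₂ ℂ (fun (f : LInf S) (a : L1 S) => ∑' s, a s * f s)
      (fun f g a => by
        rw [← (summable_pairing f a).tsum_add (summable_pairing g a)]
        exact tsum_congr fun s => by simp [mul_add])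
      (fun c f a => by
        rw [smul_eq_mul, ← tsum_mul_left]
        exact tsum_congr fun s => by simp [mul_left_comm])
      (fun f a b => by
        rw [← (summable_pairing f a).tsum_add (summable_pairing f b)]
        exact tsum_congr fun s => by simp [add_mul])
      (fun c f a => by
        rw [smul_eq_mul, ← tsum_mul_left]
        exact tsum_congr fun s => by simp [mul_assoc]))
    1
    (fun f a => by
      rw [LinearMap.mk₂_apply, one_mul, mul_comm, norm_eq_tsum, ← tsum_mul_right]
      exact tsum_of_norm_bounded ((summable_norm a).mul_right ‖f‖).hasSum (norm_mul_le f a))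

theorem pairing_apply (f : LInf S) (a : L1 S) : pairing f a = ∑' s, a s * f s := rfl

theorem pairing_delta (f : LInf S) (s : S) : pairing f (delta s) = f s := by
  classical
  rw [pairing_apply, tsum_eq_single s]
  · simp [delta]
  · intro t ht
    simp [delta, lp.single_apply, ht]

/-- The canonical map `ℓ¹(S) → E*`, `a ↦ (f ↦ ⟨f, a⟩)`, for a subspace `E ⊆ ℓ^∞(S)`. -/
def toDual (E : Submodule ℂ (LInf S)) : L1 S →L[ℂ] StrongDual ℂ E :=
  (pairing.comp E.subtypeL).flip

theorem toDual_apply (E : Submodule ℂ (LInf S)) (a : L1 S) (f : E) :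
    toDual E a f = pairing (f : LInf S) a := rfl

/-- The weak* topology `σ(ℓ¹(S), E)` that a subspace `E ⊆ ℓ^∞(S)` induces on `ℓ¹(S)`:
the coarsest topology for which every `a ↦ ⟨f, a⟩`, `f ∈ E`, is continuous. -/
@[reducible] def weakStar (E : Submodule ℂ (LInf S)) : TopologicalSpace (L1 S) :=
  TopologicalSpace.induced (fun (a : L1 S) (f : E) => pairing (f : LInf S) a)
    Pi.topologicalSpace

theorem norm_action_le (a : L1 S) (f : LInf S) (u : S → S) (s : S) :
    ‖a s * f (u s)‖ ≤ ‖a s‖ * ‖f‖ := by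
  rw [norm_mul]
  exact mul_le_mul_of_nonneg_left (norm_apply_le f _) (norm_nonneg _)

theorem memlp_action (a : L1 S) (f : LInf S) (u : S → S → S) :
    Memℓp (fun t => ∑' s, a s * f (u t s)) ∞ := by
  refine memℓp_infty ⟨‖a‖ * ‖f‖, ?_⟩
  rintro _ ⟨t, rfl⟩
  rw [norm_eq_tsum, ← tsum_mul_right]
  exact tsum_of_norm_bounded ((summable_norm a).mul_right ‖f‖).hasSum
    (norm_action_le a f (u t))

end Pairing

section Product

variable {S : Type*} [AddSemigroup S]

theorem summable_conv (a b : L1 S) :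
    Summable fun p : S × S => (a p.1 * b p.2) • delta (p.1 + p.2) := by
  refine Summable.of_norm ?_
  have h := (summable_norm a).mul_of_nonneg (summable_norm b)
    (fun _ => norm_nonneg _) (fun _ => norm_nonneg _)
  refine h.congr fun p => ?_
  simp [delta, norm_smul, lp.norm_single]

/-- The convolution product of `ℓ¹(S)`, for a semigroup `S` written additively:
the norm-convergent sum `∑ a_s b_t δ_{s+t}`. -/
def conv (a b : L1 S) : L1 S := ∑' p : S × S, (a p.1 * b p.2) • delta (p.1 + p.2)

/-- The left action `a · f` of `ℓ¹(S)` on its dual `ℓ^∞(S)`, `⟨a · f, b⟩ = ⟨f, b * a⟩`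
(see `pairing_leftAct`); in coordinates `(a · f)(t) = ⟨f, δ_t * a⟩ = ∑ₛ aₛ f(t + s)`. -/
def leftAct (a : L1 S) (f : LInf S) : LInf S :=
  ⟨fun t => ∑' s, a s * f (t + s), memlp_action a f fun t s => t + s⟩

/-- The right action `f · a` of `ℓ¹(S)` on its dual `ℓ^∞(S)`, `⟨f · a, b⟩ = ⟨f, a * b⟩`
(see `pairing_rightAct`); in coordinates `(f · a)(t) = ⟨f, a * δ_t⟩ = ∑ₛ aₛ f(s + t)`. -/
def rightAct (f : LInf S) (a : L1 S) : LInf S :=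
  ⟨fun t => ∑' s, a s * f (s + t), memlp_action a f fun t s => s + t⟩

theorem summable_triple (f : LInf S) (a b : L1 S) :
    Summable fun p : S × S => a p.1 * b p.2 * f (p.1 + p.2) := by
  have h := (summable_norm a).mul_of_nonneg (summable_norm b)
    (fun _ => norm_nonneg _) (fun _ => norm_nonneg _)
  refine Summable.of_norm_bounded (h.mul_right ‖f‖) fun p => ?_
  rw [norm_mul, norm_mul]
  exact mul_le_mul_of_nonneg_left (norm_apply_le f _) (by positivity)

theorem pairing_conv (f : LInf S) (a b : L1 S) :
    pairing f (conv a b) = ∑' p : S × S, a p.1 * b p.2 * f (p.1 + p.2) := by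
  rw [conv, (pairing f).map_tsum (summable_conv a b)]
  exact tsum_congr fun p => by rw [map_smul, pairing_delta, smul_eq_mul]

theorem pairing_leftAct (a b : L1 S) (f : LInf S) :
    pairing (leftAct a f) b = pairing f (conv b a) := by
  rw [pairing_conv, (summable_triple f b a).tsum_prod, pairing_apply]
  refine tsum_congr fun t => ?_
  simp only [leftAct, mul_assoc, tsum_mul_left]

theorem pairing_rightAct (a b : L1 S) (f : LInf S) :
    pairing (rightAct f a) b = pairing f (conv a b) := by
  have h : Summable fun p : S × S => a p.2 * b p.1 * f (p.2 + p.1) :=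
    (summable_triple f a b).prod_symm
  rw [pairing_conv, ← (Equiv.prodComm S S).tsum_eq]
  simp only [Equiv.prodComm_apply, Prod.fst_swap, Prod.snd_swap]
  rw [h.tsum_prod, pairing_apply]
  refine tsum_congr fun t => ?_
  simp only [rightAct]
  rw [← tsum_mul_left]
  exact tsum_congr fun s => by ring

/-- A predual of the Banach algebra `ℓ¹(S)`: a norm-closed sub-bimodule `E` of
`ℓ¹(S)* = ℓ^∞(S)` which is a Banach space predual of `ℓ¹(S)`, that is, the canonical map
`ℓ¹(S) → E*` is an isomorphism of Banach spaces (not necessarily isometric; a bounded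
bijection between Banach spaces is an isomorphism). -/
structure IsPredual (E : Submodule ℂ (LInf S)) : Prop where
  isClosed : IsClosed (E : Set (LInf S))
  leftAct_mem : ∀ a : L1 S, ∀ f ∈ E, leftAct a f ∈ E
  rightAct_mem : ∀ a : L1 S, ∀ f ∈ E, rightAct f a ∈ E
  bijective_toDual : Function.Bijective (toDual E)

end Product

section Coproduct

variable {S : Type*}

open Classical in
theorem memlp_coproduct (a : L1 S) :
    Memℓp (fun p : S × S => if p.1 = p.2 then a p.1 else 0) 1 := by
  refine memℓp_gen ?_
  have hinj : Function.Injective fun s : S => (s, s) := fun s t h => congrArg Prod.fst h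
  refine (hinj.summable_iff ?_).1 ?_
  · rintro ⟨s, t⟩ h
    have hst : s ≠ t := fun e => h ⟨s, by rw [e]⟩
    simp [hst]
  · simpa [Function.comp_def] using summable_norm a

open Classical in
/-- The coproduct `Γ : ℓ¹(S) → ℓ¹(S × S)`, `Γ(δ_s) = δ_{(s,s)}`. -/
def coproduct : L1 S →ₗ[ℂ] L1 (S × S) where
  toFun a := ⟨fun p => if p.1 = p.2 then a p.1 else 0, memlp_coproduct a⟩
  map_add' a b := by
    ext p
    change (if p.1 = p.2 then a p.1 + b p.1 else 0) =
      (if p.1 = p.2 then a p.1 else 0) + (if p.1 = p.2 then b p.1 else 0)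
    by_cases h : p.1 = p.2 <;> simp [h]
  map_smul' c a := by
    ext p
    change (if p.1 = p.2 then c * a p.1 else 0) = c * (if p.1 = p.2 then a p.1 else 0)
    by_cases h : p.1 = p.2 <;> simp [h]

theorem coproduct_delta (s : S) : coproduct (delta s) = delta (s, s) := by
  classical
  ext ⟨t, u⟩
  simp only [coproduct, delta, LinearMap.coe_mk, AddHom.coe_mk, lp.single_apply, Pi.single_apply,
    Prod.mk.injEq]
  grind

theorem norm_coproduct (a : L1 S) : ‖coproduct a‖ = ‖a‖ := by
  classical
  have hinj : Function.Injective fun s : S => (s, s) := fun s t h => congrArg Prod.fst h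
  rw [norm_eq_tsum, norm_eq_tsum, ← hinj.tsum_eq]
  · exact tsum_congr fun s => by simp [coproduct]
  · rintro ⟨s, t⟩ h
    by_contra hn
    have hst : s ≠ t := fun e => hn ⟨s, by rw [e]⟩
    simp [coproduct, hst] at h

/-- The elementary tensor `f ⊗ g`, the bounded function `(s, t) ↦ f(s) g(t)` on `S × S`. -/
def tmul (f g : LInf S) : LInf (S × S) :=
  ⟨fun p => f p.1 * g p.2, memℓp_infty ⟨‖f‖ * ‖g‖, by
    rintro _ ⟨p, rfl⟩
    change ‖f p.1 * g p.2‖ ≤ _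
    rw [norm_mul]
    exact mul_le_mul (norm_apply_le f _) (norm_apply_le g _) (norm_nonneg _) (norm_nonneg _)⟩⟩

/-- The injective tensor product `E ⊗̌ E`, realised as the norm closure in `ℓ^∞(S × S)` of the
span of the elementary tensors; for a predual `E` of `ℓ¹(S)`, it is the induced predual of
`ℓ¹(S × S) = ℓ¹(S) ⊗̂ ℓ¹(S)`. -/
def tensorSq (E : Submodule ℂ (LInf S)) : Submodule ℂ (LInf (S × S)) :=
  (Submodule.span ℂ {h | ∃ f ∈ E, ∃ g ∈ E, h = tmul f g}).topologicalClosure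

/-- A Hopf algebra predual of `ℓ¹(S)`: a predual of the Banach algebra `ℓ¹(S)` for which the
coproduct is also weak*-continuous. -/
structure IsHopfAlgebraPredual [AddSemigroup S] (E : Submodule ℂ (LInf S)) : Prop
    extends IsPredual E where
  continuous_coproduct : Continuous[weakStar E, weakStar (tensorSq E)] (coproduct (S := S))

end Coproduct

/-- The semigroup `ℕ_∞ = {1, 2, 3, …} ∪ {∞}` under addition, with `n + ∞ = ∞ + n = ∞ + ∞ = ∞`. -/
abbrev NInf : Type := WithTop ℕ+

/-- The space `c` of convergent sequences, as the subspace of `ℓ^∞(ℕ_∞)` of those `f` for which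
`f(n) → f(∞)` as `n → ∞`. -/
def convergentSeq : Submodule ℂ (LInf NInf) where
  carrier := {f | Tendsto (fun n : ℕ+ => f (n : NInf)) atTop (𝓝 (f (⊤ : NInf)))}
  add_mem' hf hg := Tendsto.add hf hg
  zero_mem' := tendsto_const_nhds
  smul_mem' c _ hf := Tendsto.const_mul c hf

end SemigroupPredual

end

noncomputable section

/-! The adjoint of `Γ` restricts functions to the diagonal and so sends `f ⊗ g` to `f * g`; hence
for closed `E` weak*-continuity of `Γ` means that `E` is closed under pointwise products. This gives
the Hopf property of `c`, whose dual is `ℓ¹` by the usual argument. Conversely, a Hopf algebra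
predual `E` is a subalgebra, and it contains `1` since translation by `∞` turns `f` into the
constant `f(∞)`. Every functional on `E` comes from `ℓ¹`, which forces every character to be a point
evaluation (`exists_eq_eval_of_multiplicative`). The characters are weak*-compact, so `ℕ_∞` acquires
a compact Hausdorff topology in which members of `E` are continuous; the module property makes
translations continuous. By Baire and translation every finite point is isolated, so `n → ∞` in this
topology (`tendsto_top_of_compact`) and `E ≤ c`. Hahn–Banach excludes a proper inclusion between two
preduals. -/

namespace SemigroupPredual

/-! ### Weak*-continuity, diagonal restriction and characters -/

section General

variable {S : Type*}

open Classical in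
/-- The indicator function of the point `s`, as an element of `ℓ^∞(S)`. -/
def pointIndicator (s : S) : LInf S := lp.single ∞ s (1 : ℂ)

theorem pointIndicator_self (s : S) : pointIndicator s s = 1 := by
  simp [pointIndicator]

theorem pointIndicator_of_ne {s t : S} (h : t ≠ s) : pointIndicator s t = 0 := by
  classical
  simp [pointIndicator, lp.single_apply, h]

theorem one_apply (s : S) : (1 : LInf S) s = 1 := by
  rw [lp.infty_coeFn_one]; rfl

theorem mul_apply (f g : LInf S) (s : S) : (f * g) s = f s * g s := by
  rw [lp.infty_coeFn_mul]; rfl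

theorem pairing_pointIndicator (s : S) (a : L1 S) : pairing (pointIndicator s) a = a s := by
  rw [pairing_apply, tsum_eq_single s, pointIndicator_self, mul_one]
  intro t ht
  rw [pointIndicator_of_ne ht, mul_zero]

theorem norm_delta (s : S) : ‖delta s‖ = 1 := by
  simp [delta, lp.norm_single]

theorem ext_pairing {f g : LInf S} (h : ∀ a, pairing f a = pairing g a) : f = g := by
  ext s
  rw [← pairing_delta, h, pairing_delta]

/-- Restriction to the diagonal, `ℓ^∞(S × S) → ℓ^∞(S)`. -/
def diagRestrict : LInf (S × S) →L[ℂ] LInf S :=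
  LinearMap.mkContinuous
    { toFun := fun h => ⟨fun s => h (s, s), memℓp_infty ⟨‖h‖, by
        rintro _ ⟨s, rfl⟩
        exact norm_apply_le h _⟩⟩
      map_add' := fun _ _ => rfl
      map_smul' := fun _ _ => rfl } 1
    (fun h => by
      rw [one_mul]
      exact lp.norm_le_of_forall_le (norm_nonneg _) fun s => norm_apply_le h _)

theorem diagRestrict_apply (h : LInf (S × S)) (s : S) : diagRestrict h s = h (s, s) := rfl

theorem diagRestrict_tmul (f g : LInf S) : diagRestrict (tmul f g) = f * g := by
  ext s
  rw [mul_apply]; rfl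

theorem pairing_coproduct (h : LInf (S × S)) (a : L1 S) :
    pairing h (coproduct a) = pairing (diagRestrict h) a := by
  classical
  have hinj : Function.Injective fun s : S => (s, s) := fun s t h => congrArg Prod.fst h
  rw [pairing_apply, pairing_apply, ← hinj.tsum_eq]
  · exact tsum_congr fun s => by simp [coproduct, diagRestrict_apply]
  · rintro ⟨s, t⟩ h
    by_contra hn
    have hst : s ≠ t := fun e => hn ⟨s, by rw [e]⟩
    simp [coproduct, hst] at h

theorem continuous_pairing_weakStar {E : Submodule ℂ (LInf S)} {f : LInf S} (hf : f ∈ E) :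
    Continuous[weakStar E, inferInstance] (fun a : L1 S => pairing f a) := by
  let _ := weakStar E
  exact (continuous_apply (⟨f, hf⟩ : E)).comp
    (continuous_induced_dom (f := fun (a : L1 S) (f : E) => pairing (f : LInf S) a))

/-- In a dual pair, the functionals continuous for the weak topology are exactly those given by the
other space; `E` need not be closed. -/
theorem mem_of_continuous_weakStar {E : Submodule ℂ (LInf S)} {f : LInf S}
    (hf : Continuous[weakStar E, inferInstance] (fun a : L1 S => pairing f a)) : f ∈ E := by
  let B : L1 S →ₗ[ℂ] E →ₗ[ℂ] ℂ :=
    LinearMap.mk₂ ℂ (fun a (f : E) => pairing (f : LInf S) a)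
      (by simp) (by simp) (by simp) (by simp)
  let φ : StrongDual ℂ (WeakBilin B) := ⟨(pairing f).toLinearMap, hf⟩
  obtain ⟨g, hg⟩ := LinearMap.dualEmbedding_surjective B φ
  have : (g : LInf S) = f := ext_pairing fun a => DFunLike.congr_fun hg a
  exact this ▸ g.2

/-- If `E` is a closed subalgebra of `ℓ^∞(S)`, the coproduct is weak*-continuous. -/
theorem continuous_coproduct_of_mul_mem {E : Submodule ℂ (LInf S)}
    (hE : IsClosed (E : Set (LInf S))) (hmul : ∀ f ∈ E, ∀ g ∈ E, f * g ∈ E) :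
    Continuous[weakStar E, weakStar (tensorSq E)] (coproduct (S := S)) := by
  have hle : tensorSq E ≤ E.comap diagRestrict.toLinearMap := by
    refine Submodule.topologicalClosure_minimal _ ?_ (hE.preimage diagRestrict.continuous)
    rw [Submodule.span_le]
    rintro _ ⟨f, hf, g, hg, rfl⟩
    change diagRestrict (tmul f g) ∈ E
    rw [diagRestrict_tmul]
    exact hmul f hf g hg
  let _ := weakStar E
  refine continuous_induced_rng.2 (continuous_pi fun h => ?_)
  simp only [Function.comp_apply, pairing_coproduct]
  exact continuous_pairing_weakStar (hle h.2)

/-- Pulling the weak*-continuous functional `f ⊗ g` back along `Γ` gives pairing with `f * g`. -/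
theorem mul_mem_of_continuous_coproduct {E : Submodule ℂ (LInf S)}
    (hE : Continuous[weakStar E, weakStar (tensorSq E)] (coproduct (S := S)))
    {f g : LInf S} (hf : f ∈ E) (hg : g ∈ E) : f * g ∈ E := by
  refine mem_of_continuous_weakStar ?_
  have h : tmul f g ∈ tensorSq E :=
    Submodule.le_topologicalClosure _ (Submodule.subset_span ⟨f, hf, g, hg, rfl⟩)
  have := @Continuous.comp _ _ _ (weakStar E) (weakStar (tensorSq E)) _ _ _
    (continuous_pairing_weakStar h) hE
  simpa only [Function.comp_def, pairing_coproduct, diagRestrict_tmul] using this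

/-- If `ℓ¹(S) → E*` is injective and `F ⊇ E` has `ℓ¹(S) → F*` surjective, then `E = F`
provided `E` is closed. -/
theorem eq_of_le_of_toDual {E F : Submodule ℂ (LInf S)} (hE : IsClosed (E : Set (LInf S)))
    (hle : E ≤ F) (hinj : Function.Injective (toDual E))
    (hsurj : Function.Surjective (toDual F)) : E = F := by
  refine le_antisymm hle fun x hx => ?_
  by_contra hxE
  have : IsClosed (E : Set (LInf S)) := hE
  have hne : ‖E.mkQ x‖ ≠ 0 := by
    rw [norm_ne_zero_iff]
    simpa using hxE
  -- Hahn–Banach in the quotient by `E`: the functional kills `E` but not `x`. Representing it on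
  -- `F` by some `a` gives a contradiction, as `a` must vanish.
  obtain ⟨ψ, -, hψ⟩ := exists_dual_vector ℂ (E.mkQ x) hne
  obtain ⟨a, ha⟩ := hsurj ((ψ.comp E.mkQL).comp F.subtypeL)
  have hpair : ∀ f ∈ F, pairing f a = ψ (E.mkQ f) := fun f hf =>
    DFunLike.congr_fun ha (⟨f, hf⟩ : F)
  have h0 : a = 0 := by
    refine hinj ?_
    ext f
    rw [toDual_apply, hpair _ (hle f.2), map_zero]
    have : E.mkQ (f : LInf S) = 0 := by simp
    rw [this, map_zero]; rfl
  have := hpair x hx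
  rw [h0, map_zero, hψ] at this
  exact hne (Complex.ofReal_eq_zero.1 this.symm)

/-- If `E` is a subalgebra of `ℓ^∞(S)` for which `ℓ¹(S) → E*` is bijective, then every nonzero
multiplicative functional on `E` is a point evaluation. -/
theorem exists_eq_eval_of_multiplicative {E : Submodule ℂ (LInf S)}
    (hE : Function.Bijective (toDual E)) (hmul : ∀ f ∈ E, ∀ g ∈ E, f * g ∈ E)
    (φ : StrongDual ℂ E) (hφ : φ ≠ 0)
    (hφm : ∀ f g : E, φ ⟨f * g, hmul f f.2 g g.2⟩ = φ f * φ g) :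
    ∃ s, ∀ f : E, φ f = (f : LInf S) s := by
  obtain ⟨a, rfl⟩ := hE.2 φ
  obtain ⟨s, hs⟩ : ∃ s, a s ≠ 0 := by
    by_contra! h
    exact hφ (by rw [show a = 0 from lp.ext (funext h), map_zero])
  refine ⟨s, fun g => ?_⟩
  -- Multiplicativity says that `g · a` and `φ(g) a` define the same functional on `E`, so they
  -- coincide; at a coordinate with `a s ≠ 0` this reads `g(s) = φ(g)`.
  let ga : L1 S := ⟨fun t => a t * (g : LInf S) t, by
    refine memℓp_gen ?_
    simpa using Summable.of_nonneg_of_le (fun _ => norm_nonneg _) (norm_mul_le (g : LInf S) a)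
      ((summable_norm a).mul_right _)⟩
  have h : ga = toDual E a g • a := by
    refine hE.1 ?_
    ext f
    have := hφm g f
    simp only [toDual_apply] at this
    rw [map_smul, smul_apply, smul_eq_mul]
    simp only [toDual_apply]
    rw [← this, pairing_apply, pairing_apply]
    refine tsum_congr fun t => ?_
    simp only [mul_apply, ga, mul_assoc]
  have h2 := congrArg (fun b : L1 S => b s) h
  simp only [ga, lp.coeFn_smul, Pi.smul_apply, smul_eq_mul] at h2
  rw [mul_comm] at h2
  exact (mul_right_cancel₀ hs h2).symm

end General

/-! ### The space `c` is a Hopf algebra predual -/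

theorem mem_convergentSeq {f : LInf NInf} :
    f ∈ convergentSeq ↔ Tendsto (fun n : ℕ+ => f (n : NInf)) atTop (𝓝 (f ⊤)) := Iff.rfl

theorem isClosed_convergentSeq : IsClosed (convergentSeq : Set (LInf NInf)) := by
  refine isClosed_of_closure_subset fun f hf => ?_
  change Tendsto _ _ _
  rw [Metric.tendsto_nhds]
  intro ε hε
  obtain ⟨g, hg, hfg⟩ := Metric.mem_closure_iff.1 hf (ε / 3) (by positivity)
  have h := Metric.tendsto_nhds.1 (mem_convergentSeq.1 hg) (ε / 3) (by positivity)
  have hd : ∀ s, dist (f s) (g s) < ε / 3 := fun s => by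
    rw [dist_eq_norm] at hfg ⊢
    exact (norm_apply_le (f - g) s).trans_lt hfg
  filter_upwards [h] with n hn
  have h1 := dist_triangle4 (f n) (g n) (g ⊤) (f ⊤)
  have h2 := hd n
  have h3 := hd ⊤
  rw [dist_comm] at h3
  linarith

theorem one_mem_convergentSeq : (1 : LInf NInf) ∈ convergentSeq := by
  rw [mem_convergentSeq]
  simp only [one_apply]
  exact tendsto_const_nhds

theorem pointIndicator_mem_convergentSeq (m : ℕ+) :
    pointIndicator (m : NInf) ∈ convergentSeq := by
  rw [mem_convergentSeq, pointIndicator_of_ne (by simp)]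
  refine tendsto_const_nhds.congr' ?_
  filter_upwards [eventually_gt_atTop m] with n hn
  rw [pointIndicator_of_ne (by simpa using hn.ne')]

theorem mul_mem_convergentSeq {f g : LInf NInf} (hf : f ∈ convergentSeq)
    (hg : g ∈ convergentSeq) : f * g ∈ convergentSeq := by
  rw [mem_convergentSeq]
  simp only [mul_apply]
  exact Tendsto.mul hf hg

theorem rightAct_eq_leftAct (a : L1 NInf) (f : LInf NInf) : rightAct f a = leftAct a f := by
  ext t
  simp only [rightAct, leftAct, add_comm]

theorem leftAct_mem_convergentSeq (a : L1 NInf) {f : LInf NInf} (hf : f ∈ convergentSeq) :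
    leftAct a f ∈ convergentSeq := by
  rw [mem_convergentSeq]
  refine tendsto_tsum_of_dominated_convergence ((summable_norm a).mul_right ‖f‖) (fun s => ?_)
    (Eventually.of_forall fun n s => norm_action_le a f (fun t => (n : NInf) + t) s)
  refine Tendsto.const_mul _ ?_
  induction s using WithTop.recTopCoe with
  | top => simp
  | coe k =>
    change Tendsto (fun n : ℕ+ => f ((n + k : ℕ+) : NInf)) atTop (𝓝 (f ⊤))
    exact (mem_convergentSeq.1 hf).comp
      (tendsto_atTop_mono (fun n => (PNat.lt_add_right n k).le) tendsto_id)

theorem injective_toDual_convergentSeq : Function.Injective (toDual convergentSeq) := by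
  rw [injective_iff_map_eq_zero]
  intro a ha
  have h : ∀ f ∈ convergentSeq, pairing f a = 0 := fun f hf =>
    DFunLike.congr_fun ha (⟨f, hf⟩ : convergentSeq)
  have hfin : ∀ n : ℕ+, a (n : NInf) = 0 := fun n => by
    rw [← pairing_pointIndicator]
    exact h _ (pointIndicator_mem_convergentSeq n)
  have htop : a ⊤ = 0 := by
    have h1 := h 1 one_mem_convergentSeq
    rw [pairing_apply, tsum_eq_single ⊤] at h1
    · simpa only [one_apply, mul_one] using h1
    · intro s hs
      lift s to ℕ+ using hs
      rw [hfin, zero_mul]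
  ext s
  induction s using WithTop.recTopCoe with
  | top => exact htop
  | coe n => exact hfin n

/-- The values of a bounded functional on `ℓ^∞(S)` at the point indicators are summable. -/
theorem summable_norm_apply_pointIndicator {S : Type*} (Φ : StrongDual ℂ (LInf S)) :
    Summable fun s => ‖Φ (pointIndicator s)‖ := by
  classical
  refine summable_of_sum_le (c := ‖Φ‖) (fun _ => norm_nonneg _) fun F => ?_
  -- Phases aligning the values of `Φ`: the test vector `∑ c s • pointIndicator s` has norm at most
  -- 1 and detects the whole sum.
  choose c hc1 hc using fun s : S => show ∃ c : ℂ, ‖c‖ ≤ 1 ∧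
      c * Φ (pointIndicator s) = ‖Φ (pointIndicator s)‖ from by
    by_cases h : Φ (pointIndicator s) = 0
    · exact ⟨0, by simp, by simp [h]⟩
    · have h' : (‖Φ (pointIndicator s)‖ : ℂ) ≠ 0 := by simpa using h
      refine ⟨(starRingEnd ℂ) (Φ (pointIndicator s)) / ‖Φ (pointIndicator s)‖, ?_, ?_⟩
      · rw [norm_div, RCLike.norm_conj, Complex.norm_real, norm_norm]
        exact div_self_le_one _
      · rw [div_mul_eq_mul_div, mul_comm, Complex.mul_conj', sq, mul_div_assoc, div_self h', mul_one]
  have hnorm : ‖∑ s ∈ F, c s • pointIndicator s‖ ≤ 1 := by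
    refine lp.norm_le_of_forall_le zero_le_one fun t => ?_
    rw [lp.coeFn_sum, Finset.sum_apply]
    by_cases ht : t ∈ F
    · rw [Finset.sum_eq_single_of_mem t ht]
      · simpa [pointIndicator_self] using hc1 t
      · intro s _ hs
        simp [pointIndicator_of_ne hs.symm]
    · rw [Finset.sum_eq_zero]
      · simp
      · intro s hs
        simp [pointIndicator_of_ne (show t ≠ s from fun h => ht (h ▸ hs))]
  have h : ((∑ s ∈ F, ‖Φ (pointIndicator s)‖ : ℝ) : ℂ) = Φ (∑ s ∈ F, c s • pointIndicator s) := by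
    rw [map_sum, Complex.ofReal_sum]
    exact Finset.sum_congr rfl fun s _ => by rw [map_smul, smul_eq_mul, hc]
  calc ∑ s ∈ F, ‖Φ (pointIndicator s)‖
      = ‖((∑ s ∈ F, ‖Φ (pointIndicator s)‖ : ℝ) : ℂ)‖ := by
        rw [Complex.norm_real, Real.norm_of_nonneg (Finset.sum_nonneg fun _ _ => norm_nonneg _)]
    _ ≤ ‖Φ‖ * ‖∑ s ∈ F, c s • pointIndicator s‖ := by rw [h]; exact Φ.le_opNorm _
    _ ≤ ‖Φ‖ := mul_le_of_le_one_right (norm_nonneg _) hnorm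

/-- The constants and the indicators of finite points span a dense subspace of `c`. -/
theorem convergentSeq_le_of_isClosed {F : Submodule ℂ (LInf NInf)}
    (hF : IsClosed (F : Set (LInf NInf))) (h1 : 1 ∈ F)
    (hn : ∀ n : ℕ+, pointIndicator (n : NInf) ∈ F) : convergentSeq ≤ F := by
  intro f hf
  refine hF.closure_subset (Metric.mem_closure_iff.2 fun ε hε => ?_)
  obtain ⟨N, hN⟩ := eventually_atTop.1 (Metric.tendsto_nhds.1 (mem_convergentSeq.1 hf) (ε / 2)
    (by positivity))
  -- This agrees with `f` below `N` and at `∞`, and equals `f ⊤` at finite points from `N` on.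
  let g : LInf NInf := f ⊤ • (1 : LInf NInf) +
    ∑ n ∈ Finset.Iio N, (f n - f ⊤) • pointIndicator (n : NInf)
  refine ⟨g, F.add_mem (F.smul_mem _ h1) (F.sum_mem fun n _ => F.smul_mem _ (hn n)), ?_⟩
  rw [dist_eq_norm]
  refine (lp.norm_le_of_forall_le (half_pos hε).le fun s => ?_).trans_lt (half_lt_self hε)
  have hg : g s = f ⊤ + ∑ n ∈ Finset.Iio N, (f n - f ⊤) * pointIndicator (n : NInf) s := by
    simp only [g, lp.coeFn_add, lp.coeFn_smul, lp.coeFn_sum, Pi.add_apply, Finset.sum_apply,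
      Pi.smul_apply, one_apply, smul_eq_mul, mul_one]
  rw [lp.coeFn_sub, Pi.sub_apply, hg]
  induction s using WithTop.recTopCoe with
  | top =>
    rw [Finset.sum_eq_zero fun n _ => by rw [pointIndicator_of_ne (by simp), mul_zero]]
    simpa using (half_pos hε).le
  | coe m =>
    by_cases hm : m < N
    · rw [Finset.sum_eq_single_of_mem m (Finset.mem_Iio.2 hm)]
      · simpa [pointIndicator_self] using (half_pos hε).le
      · intro n _ hnm
        rw [pointIndicator_of_ne (by simpa using hnm.symm), mul_zero]
    · rw [Finset.sum_eq_zero, add_zero, ← dist_eq_norm]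
      · exact (hN m (not_lt.1 hm)).le
      · intro n hn
        rw [pointIndicator_of_ne, mul_zero]
        have := Finset.mem_Iio.1 hn
        simpa using fun h : m = n => hm (h ▸ this)

theorem surjective_toDual_convergentSeq : Function.Surjective (toDual convergentSeq) := by
  intro φ
  obtain ⟨Φ, hΦ, -⟩ := exists_extension_norm_eq convergentSeq φ
  have hsum : Summable fun n : ℕ+ => ‖Φ (pointIndicator (n : NInf))‖ :=
    (summable_norm_apply_pointIndicator Φ).comp_injective WithTop.coe_injective
  have hsum1 : Summable fun n : ℕ+ => Φ (pointIndicator (n : NInf)) • delta (n : NInf) := by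
    refine Summable.of_norm ?_
    simpa only [norm_smul, norm_delta, mul_one] using hsum
  let b : L1 NInf := ∑' n : ℕ+, Φ (pointIndicator (n : NInf)) • delta (n : NInf)
  -- The mass at `∞` corrects the value at `1` without affecting the finite point indicators.
  let a : L1 NInf := b + (Φ 1 - pairing 1 b) • delta ⊤
  have hle : convergentSeq ≤ (Φ - pairing.flip a).ker := by
    refine convergentSeq_le_of_isClosed (Φ - pairing.flip a).isClosed_ker ?_ fun m => ?_
    · simp [a, pairing_delta, one_apply]
    · have hb : pairing (pointIndicator (m : NInf)) b = Φ (pointIndicator (m : NInf)) := by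
        rw [(pairing _).map_tsum hsum1, tsum_eq_single m]
        · simp [pairing_delta, pointIndicator_self]
        · intro n hn
          rw [map_smul, pairing_delta, pointIndicator_of_ne (by simpa using hn), smul_zero]
      simp [a, pairing_delta, hb, pointIndicator_of_ne]
  refine ⟨a, ?_⟩
  ext f
  have h : (Φ - pairing.flip a) f = 0 := hle f.2
  rw [← hΦ, toDual_apply]
  exact (sub_eq_zero.1 h).symm

theorem isHopfAlgebraPredual_convergentSeq : IsHopfAlgebraPredual convergentSeq where
  isClosed := isClosed_convergentSeq
  leftAct_mem a _ hf := leftAct_mem_convergentSeq a hf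
  rightAct_mem a f hf := rightAct_eq_leftAct a f ▸ leftAct_mem_convergentSeq a hf
  bijective_toDual := ⟨injective_toDual_convergentSeq, surjective_toDual_convergentSeq⟩
  continuous_coproduct := continuous_coproduct_of_mul_mem isClosed_convergentSeq
    fun _ hf _ hg => mul_mem_convergentSeq hf hg

/-! ### Rigidity of the topology on `ℕ_∞` -/

/-- A compact Hausdorff topology on `ℕ_∞` for which all translations `s ↦ s + k` are continuous
is the usual topology: `n → ∞`. -/
theorem tendsto_top_of_compact {X : Type*} [TopologicalSpace X] [CompactSpace X] [T2Space X]
    (e : NInf ≃ X) (hshift : ∀ k : NInf, Continuous fun x => e (e.symm x + k)) :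
    Tendsto (fun n : ℕ+ => e (n : NInf)) atTop (𝓝 (e ⊤)) := by
  have : Countable NInf := inferInstanceAs (Countable (Option ℕ+))
  have : Infinite NInf := inferInstanceAs (Infinite (Option ℕ+))
  have : Countable X := e.symm.injective.countable
  have : Infinite X := e.symm.infinite_iff.2 inferInstance
  let D : Set X := {x | IsOpen ({x} : Set X)}
  -- Baire: `X` is a countable union of closed singletons, so those with nonempty interior are
  -- dense.
  have hD : Dense D := by
    refine (dense_iUnion_interior_of_closed (f := fun x : X => ({x} : Set X))
      (fun x => isClosed_singleton) (Set.iUnion_of_singleton X)).mono ?_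
    rintro x hx
    obtain ⟨y, hy⟩ := Set.mem_iUnion.1 hx
    obtain rfl : x = y := Set.mem_singleton_iff.1 (interior_subset hy)
    have : interior {x} = ({x} : Set X) :=
      interior_subset.antisymm (Set.singleton_subset_iff.2 hy)
    exact interior_eq_iff_isOpen.1 this
  have hDinf : D.Infinite := fun hfin => by
    have := hfin.isClosed.closure_eq
    rw [hD.closure_eq] at this
    exact Set.infinite_univ (this ▸ hfin)
  have hopen : ∀ n : ℕ+, IsOpen ({e n} : Set X) := by
    intro n
    -- An isolated finite point `n + k` beyond `n`; its preimage under translation by `k` is exactly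
    -- `n`, because `∞` is fixed and cancellation holds in `ℕ+`.
    obtain ⟨x, hxD, hx⟩ := hDinf.exists_notMem_finite
      (((Set.finite_Iic n).image fun m : ℕ+ => e (m : NInf)).insert (e ⊤))
    obtain ⟨s, rfl⟩ := e.surjective x
    induction s using WithTop.recTopCoe with
    | top => simp at hx
    | coe m =>
      have hnm : n < m := by
        by_contra! h
        exact hx (Or.inr ⟨m, h, rfl⟩)
      obtain ⟨k, rfl⟩ : ∃ k, n + k = m := ⟨m - n, PNat.add_sub_of_lt hnm⟩
      have : ({e n} : Set X) =
          (fun x => e (e.symm x + (k : NInf))) ⁻¹' {e ((n + k : ℕ+) : NInf)} := by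
        ext y
        obtain ⟨t, rfl⟩ := e.surjective y
        simp only [Set.mem_singleton_iff, Set.mem_preimage, e.symm_apply_apply,
          EmbeddingLike.apply_eq_iff_eq]
        induction t using WithTop.recTopCoe with
        | top => exact iff_of_false WithTop.top_ne_coe WithTop.top_ne_coe
        | coe t => norm_cast; simp
      rw [this]
      exact IsOpen.preimage (hshift k) hxD
  rw [tendsto_nhds]
  intro U hU hmem
  -- The complement is compact and, as it omits `∞`, discrete.
  have hfin : (Uᶜ).Finite := by
    refine (hU.isClosed_compl.isCompact).finite ?_
    refine ⟨discreteTopology_iff_isOpen_singleton.2 ?_⟩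
    rintro ⟨x, hx⟩
    obtain ⟨s, rfl⟩ := e.surjective x
    induction s using WithTop.recTopCoe with
    | top => exact absurd hmem hx
    | coe n =>
      convert (hopen n).preimage continuous_subtype_val using 1
      ext y
      simp [Subtype.ext_iff]
  have : ((fun n : ℕ+ => e (n : NInf)) ⁻¹' Uᶜ).Finite :=
    hfin.preimage (fun a _ b _ h => by simpa using h)
  obtain ⟨N, hN⟩ := this.bddAbove
  filter_upwards [eventually_gt_atTop N] with n hn
  by_contra h
  exact absurd (hN h) (not_le.2 hn)

/-! ### Compactness of the set of point evaluations -/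

section General

variable {S : Type*}

/-- Evaluation at the point `s`, as a functional on `E`. -/
def evalPoint (E : Submodule ℂ (LInf S)) (s : S) : WeakDual ℂ E :=
  StrongDual.toWeakDual (toDual E (delta s))

theorem evalPoint_apply (E : Submodule ℂ (LInf S)) (s : S) (f : E) :
    evalPoint E s f = (f : LInf S) s :=
  pairing_delta (f : LInf S) s

theorem injective_delta : Function.Injective (delta : S → L1 S) := by
  classical
  intro s t h
  by_contra hst
  have := congrArg (fun a : L1 S => a s) h
  simp [delta, lp.single_apply, hst] at this

/-- If a closed unital subalgebra `E` of `ℓ^∞(S)` is a predual of `ℓ¹(S)`, then the points of `S`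
form a weak*-compact subset of `E*`. -/
theorem isCompact_range_evalPoint {E : Submodule ℂ (LInf S)}
    (hE : Function.Bijective (toDual E)) (h1 : 1 ∈ E) (hmul : ∀ f ∈ E, ∀ g ∈ E, f * g ∈ E) :
    IsCompact (Set.range (evalPoint E)) := by
  refine WeakDual.isCompact_of_bounded_of_closed ?_ ?_
  · refine (WeakDual.isBounded_closedBall (𝕜 := ℂ) (E := E) 0 1).subset ?_
    rintro _ ⟨s, rfl⟩
    refine (mem_closedBall_zero_iff (E := StrongDual ℂ E)).2 ?_
    refine ContinuousLinearMap.opNorm_le_bound _ zero_le_one fun f => ?_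
    rw [one_mul]
    change ‖evalPoint E s f‖ ≤ _
    rw [evalPoint_apply]
    exact norm_apply_le _ s
  -- The point evaluations are all the unital characters, and these are cut out by weak*-closed
  -- equations.
  · have : Set.range (evalPoint E) = {φ : WeakDual ℂ E | φ ⟨1, h1⟩ = 1} ∩
        ⋂ (f : E) (g : E), {φ : WeakDual ℂ E | φ ⟨f * g, hmul f f.2 g g.2⟩ = φ f * φ g} := by
      ext φ
      simp only [Set.mem_range, Set.mem_inter_iff, Set.mem_iInter, Set.mem_ofPred_eq]
      constructor
      · rintro ⟨s, rfl⟩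
        simp only [evalPoint_apply, one_apply, mul_apply, implies_true, and_self]
      · rintro ⟨hφ1, hφm⟩
        have hφ0 : WeakDual.toStrongDual φ ≠ 0 := fun h => by
          have := DFunLike.congr_fun h ⟨1, h1⟩
          change φ ⟨1, h1⟩ = 0 at this
          rw [hφ1] at this
          exact one_ne_zero this
        obtain ⟨s, hs⟩ := exists_eq_eval_of_multiplicative hE hmul (WeakDual.toStrongDual φ) hφ0 hφm
        refine ⟨s, ?_⟩
        refine DFunLike.ext _ _ fun f => ?_
        rw [evalPoint_apply]
        exact (hs f).symm
    rw [this]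
    refine IsClosed.inter (isClosed_eq (WeakDual.eval_continuous _) continuous_const) ?_
    exact isClosed_iInter fun f => isClosed_iInter fun g =>
      isClosed_eq (WeakDual.eval_continuous _)
        ((WeakDual.eval_continuous _).mul (WeakDual.eval_continuous _))

end General

/-! ### Every Hopf algebra predual lies in `c` -/

theorem rightAct_delta_apply {S : Type*} [AddSemigroup S] (f : LInf S) (s t : S) :
    rightAct f (delta s) t = f (s + t) := by
  classical
  change ∑' u, delta s u * f (u + t) = _
  rw [tsum_eq_single s]
  · simp [delta]
  · intro u hu
    simp [delta, lp.single_apply, hu]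

/-- Since `∞` is absorbing, `f · δ_∞` is the constant `f(∞)`; some `f ∈ E` has `f(∞) ≠ 0`, as
otherwise `δ_∞` would vanish on `E`. -/
theorem one_mem_of_isPredual {E : Submodule ℂ (LInf NInf)} (hE : IsPredual E) : 1 ∈ E := by
  obtain ⟨f, hf⟩ : ∃ f : E, (f : LInf NInf) ⊤ ≠ 0 := by
    by_contra! h
    have : toDual E (delta ⊤) = toDual E 0 := by
      ext f
      rw [toDual_apply, pairing_delta, h, map_zero]; rfl
    have := congrArg norm (hE.bijective_toDual.1 this)
    simp [norm_delta] at this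
  have h : (1 : LInf NInf) = ((f : LInf NInf) ⊤)⁻¹ • rightAct f (delta ⊤) := by
    ext s
    rw [lp.coeFn_smul, Pi.smul_apply, rightAct_delta_apply, one_apply, smul_eq_mul]
    exact (inv_mul_cancel₀ hf).symm
  rw [h]
  exact E.smul_mem _ (hE.rightAct_mem _ _ f.2)

theorem le_convergentSeq_of_isHopfAlgebraPredual {E : Submodule ℂ (LInf NInf)}
    (hE : IsHopfAlgebraPredual E) : E ≤ convergentSeq := by
  have hmul : ∀ f ∈ E, ∀ g ∈ E, f * g ∈ E := fun f hf g hg =>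
    mul_mem_of_continuous_coproduct hE.continuous_coproduct hf hg
  have hcomp := isCompact_range_evalPoint hE.bijective_toDual
    (one_mem_of_isPredual hE.toIsPredual) hmul
  have : CompactSpace (Set.range (evalPoint E)) := isCompact_iff_compactSpace.1 hcomp
  have hinj : Function.Injective (evalPoint E) := fun s t h =>
    injective_delta (hE.bijective_toDual.1 h)
  let e : NInf ≃ Set.range (evalPoint E) := Equiv.ofInjective _ hinj
  have hval : ∀ x (f : E), (f : LInf NInf) (e.symm x) = (x : WeakDual ℂ E) f := fun x f => by
    obtain ⟨s, rfl⟩ := e.surjective x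
    rw [e.symm_apply_apply]
    exact (evalPoint_apply E s f).symm
  have htend := tendsto_top_of_compact e fun k => by
    refine Continuous.subtype_mk (f := fun x => evalPoint E (e.symm x + k))
      (WeakDual.continuous_of_continuous_eval fun f => ?_) _
    -- Evaluating `f` at a translate is evaluating `f · δ_k`, again in `E`, at the original point;
    -- hence translations are weak*-continuous.
    have : ∀ x, evalPoint E (e.symm x + k) f =
        (x : WeakDual ℂ E) ⟨_, hE.rightAct_mem (delta k) f f.2⟩ := fun x => by
      rw [← hval, evalPoint_apply, rightAct_delta_apply, add_comm]
    simp only [this]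
    exact (WeakDual.eval_continuous _).comp continuous_subtype_val
  intro f hf
  rw [mem_convergentSeq]
  have := (((WeakDual.eval_continuous (⟨f, hf⟩ : E)).comp continuous_subtype_val).tendsto _).comp
    htend
  simpa only [Function.comp_def, ← hval, e.symm_apply_apply] using this

end SemigroupPredual
end

theorem mainTheorem10 (E : Submodule ℂ (SemigroupPredual.LInf SemigroupPredual.NInf)) :
    SemigroupPredual.IsHopfAlgebraPredual E ↔ E = SemigroupPredual.convergentSeq := by
  refine ⟨fun hE => ?_, fun h => h ▸ SemigroupPredual.isHopfAlgebraPredual_convergentSeq⟩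
  exact SemigroupPredual.eq_of_le_of_toDual hE.isClosed
    (SemigroupPredual.le_convergentSeq_of_isHopfAlgebraPredual hE) hE.bijective_toDual.1
    SemigroupPredual.surjective_toDual_convergentSeq
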